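/- Let $I\subset\mathbb R$ be a non-degenerate interval, and let $(S^2,\sigma_{AB})$ be the unit round sphere in $\mathbb R^3$ with Levi-Civita connection $\nabla$, volume form $\epsilon_{AB}$ and area measure; indices are raised, lowered and contracted with $\sigma$. Let $\tilde X^k$, $k=1,2,3$, be the restrictions to $S^2$ of the coordinate functions of $\mathbb R^3$. Let $(m,N_A,C_{AB},N_{AB})$ be (vacuum) null infinity data on $I\times S^2$ in Bondi–Sachs coordinates: a smooth function $m$ (mass aspect), a smooth one-form $N_A$ (angular momentum aspect), and smooth symmetric traceless 2-tensors $C_{AB}$ (shear) and $N_{AB}$ (news) on $S^2$, depending smoothly on $u\in I$, with $\partial_uC_{AB}=N_{AB}$ and satisfying the equations which the vacuum Einstein equations impose at null infinity, $$\partial_u m=-\tfrac18N_{AB}N^{AB}+\tfrac14\nabla^A\nabla^BN_{AB},$$ $$\partial_uN_A=\nabla_Am-\tfrac14\nabla^D(\nabla_D\nabla^EC_{EA}-\nabla_A\nabla^EC_{ED})+\tfrac14\nabla_A(C_{BE}N^{BE})-\tfrac14\nabla_B(C^{BD}N_{DA})+\tfrac12C_{AB}\nabla_DN^{DB}.$$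 Define the classical (Dray–Streubel) angular momentum and center of mass, for $k=1,2,3$ and $u\in I$, by $$\tilde J^k=\int_{S^2}\epsilon^{AB}\nabla_B\tilde X^k\Big[N_A-\tfrac14C_A{}^D\nabla^EC_{DE}\Big],$$ $$\tilde C^k=\int_{S^2}\nabla^A\tilde X^k\Big[N_A-u\nabla_Am-\tfrac14C_A{}^D\nabla^EC_{DE}-\tfrac1{16}\nabla_A(C_{DE}C^{DE})\Big].$$ Then $\tilde J^k$ and $\tilde C^k$ are differentiable in $u\in I$ (one-sidedly at endpoints of $I$ belonging to $I$), and $$\partial_u\tilde J^k=\frac14\int_{S^2}\Big[\epsilon^{AE}\nabla_E\tilde X^k\big(C_{AB}\nabla_DN^{BD}-N_{AB}\nabla_DC^{BD}\big)+\tilde X^k\epsilon^{AB}C_A{}^DN_{DB}\Big],$$ $$\partial_u\tilde C^k=\frac14\int_{S^2}\nabla^A\tilde X^k\Big(\frac u2\nabla_A|N|^2+C_{AB}\nabla_DN^{BD}-N_{AB}\nabla_DC^{BD}\Big),$$ where $|N|^2=N_{AB}N^{AB}$. -/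

import Mathlib

open MeasureTheory


noncomputable section

namespace BondiSachs

open scoped Manifold ContDiff

/-- Euclidean space `ℝ³`. -/
abbrev E3 : Type := EuclideanSpace ℝ (Fin 3)

/-- The standard unit two-sphere in `ℝ³`. -/
abbrev S2 : Type := Metric.sphere (0 : E3) 1

instance factFinrankE3 : Fact (Module.finrank ℝ E3 = 2 + 1) := ⟨by simp⟩

/-! Tensor fields on `S²` are described through the embedding `S² ⊂ ℝ³`: a covariant tensor at `x`
is given by its components in the standard basis of `ℝ³`, all of whose contractions with the unit
normal `x` vanish. For such tangential tensors raising, lowering and contracting indices with the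
round metric `σ` is the Euclidean operation on components. -/

/-- One-forms on `S²`, in ambient components. -/
abbrev OneForm : Type := S2 → Fin 3 → ℝ

/-- Covariant two-tensors on `S²`, in ambient components. -/
abbrev TwoTensor : Type := S2 → Fin 3 → Fin 3 → ℝ

/-- The radial retraction `y ↦ y / ‖y‖` of `ℝ³ ∖ {0}` onto `S²` (the value at `0` is irrelevant). -/
def retract (y : E3) : S2 :=
  if h : y = 0 then ⟨EuclideanSpace.single 0 1, by simp⟩
  else ⟨‖y‖⁻¹ • y, by simp [norm_smul, h]⟩

/-- The differential `∇_a f` of a function on `S²`: the Euclidean differential of the extension of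
`f` that is constant along rays. It annihilates the normal direction. -/
def grad (f : S2 → ℝ) : OneForm := fun x a =>
  fderiv ℝ (fun y : E3 => f (retract y)) (x : E3) (EuclideanSpace.single a 1)

/-- The round metric `σ_{ab} = δ_{ab} - x_a x_b`, which is also the orthogonal projection of `ℝ³`
onto the tangent plane at `x`. -/
def sigma (x : S2) (a b : Fin 3) : ℝ :=
  (if a = b then 1 else 0) - (x : E3) a * (x : E3) b

/-- The volume form of the round metric, `ε_{ab} = ∑_c ε_{abc} x_c`, that is,
`ε(v, w) = ⟨x, v × w⟩`. -/
def eps (x : S2) : Fin 3 → Fin 3 → ℝ :=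
  ![![0, (x : E3) 2, -(x : E3) 1],
    ![-(x : E3) 2, 0, (x : E3) 0],
    ![(x : E3) 1, -(x : E3) 0, 0]]

/-- The Levi-Civita covariant derivative `∇_a w_b` of a one-form: the tangential part of the
Euclidean derivative. The first index is the index of differentiation. -/
def cov1 (w : OneForm) : TwoTensor := fun x a b =>
  ∑ b', sigma x b b' * grad (fun y => w y b') x a

/-- The Levi-Civita covariant derivative `∇_a T_{bc}` of a two-tensor. The first index is the index
of differentiation. -/
def cov2 (T : TwoTensor) (x : S2) (a b c : Fin 3) : ℝ :=
  ∑ b', ∑ c', sigma x b b' * sigma x c c' * grad (fun y => T y b' c') x a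

/-- The divergence `∇^a w_a` of a one-form. -/
def div1 (w : OneForm) (x : S2) : ℝ := ∑ a, cov1 w x a a

/-- The divergence `∇^a T_{ab}` of a two-tensor. -/
def div2 (T : TwoTensor) : OneForm := fun x b => ∑ a, cov2 T x a a b

/-- The contraction `T_a^{ d} w_d`. -/
def contr (T : TwoTensor) (w : OneForm) : OneForm := fun x a => ∑ d, T x a d * w x d

/-- The product `S_a^{ d} T_{db}` of two-tensors. -/
def mul2 (S T : TwoTensor) : TwoTensor := fun x a b => ∑ d, S x a d * T x d b

/-- The full contraction `S_{ab} T^{ab}`. -/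
def inner2 (S T : TwoTensor) (x : S2) : ℝ := ∑ a, ∑ b, S x a b * T x a b

/-- The squared norm `|T|² = T_{ab} T^{ab}`. -/
def normSq2 (T : TwoTensor) : S2 → ℝ := inner2 T T

/-- The function `X̃^k`: the restriction to `S²` of the `k`-th coordinate function of `ℝ³`. -/
def coordFn (k : Fin 3) (x : S2) : ℝ := (x : E3) k

/-- The area measure of the unit sphere (of total mass `4π`). -/
def area : Measure S2 := (volume : Measure E3).toSphere

/-- Joint smoothness on `I × S²` of a function on the sphere that depends on `u ∈ I`. -/
def SmoothOn (I : Set ℝ) (f : ℝ → S2 → ℝ) : Prop :=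
  ContMDiffOn (𝓘(ℝ, ℝ).prod (𝓡 2)) 𝓘(ℝ, ℝ) ∞ (fun p : ℝ × S2 => f p.1 p.2) (I ×ˢ Set.univ)

/-- A smooth one-form on `S²` depending smoothly on `u ∈ I`. -/
structure IsSmoothOneForm (I : Set ℝ) (w : ℝ → OneForm) : Prop where
  smooth : ∀ a, SmoothOn I (fun u x => w u x a)
  tangent : ∀ u ∈ I, ∀ x : S2, ∑ a, (x : E3) a * w u x a = 0

/-- A smooth symmetric traceless two-tensor on `S²` depending smoothly on `u ∈ I`. -/
structure IsSmoothSymTraceless (I : Set ℝ) (T : ℝ → TwoTensor) : Prop where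
  smooth : ∀ a b, SmoothOn I (fun u x => T u x a b)
  symm : ∀ u ∈ I, ∀ x a b, T u x a b = T u x b a
  tangent : ∀ u ∈ I, ∀ (x : S2) (b : Fin 3), ∑ a, (x : E3) a * T u x a b = 0
  traceless : ∀ u ∈ I, ∀ x, ∑ a, T u x a a = 0

/-- Null infinity data on `I × S²`: a mass aspect `m`, an angular momentum aspect `N_A`, a shear
tensor `C_{AB}` and the news tensor `N_{AB} = ∂_u C_{AB}`, subject to the equations that the vacuum
Einstein equations impose on them at null infinity:

`∂_u m = -1/8 N_{AB} N^{AB} + 1/4 ∇^A ∇^B N_{AB}`,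

`∂_u N_A = ∇_A m - 1/4 ∇^D (∇_D ∇^E C_{EA} - ∇_A ∇^E C_{ED}) + 1/4 ∇_A (C_{BE} N^{BE})
  - 1/4 ∇_B (C^{BD} N_{DA}) + 1/2 C_{AB} ∇_D N^{DB}`. -/
structure NullInfinityData (I : Set ℝ) where
  /-- the mass aspect `m` -/
  m : ℝ → S2 → ℝ
  /-- the angular momentum aspect `N_A` -/
  ang : ℝ → OneForm
  /-- the shear tensor `C_{AB}` -/
  shear : ℝ → TwoTensor
  /-- the news tensor `N_{AB}` -/
  news : ℝ → TwoTensor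
  smooth_m : SmoothOn I m
  smooth_ang : IsSmoothOneForm I ang
  smooth_shear : IsSmoothSymTraceless I shear
  smooth_news : IsSmoothSymTraceless I news
  shear_evol : ∀ u ∈ I, ∀ x a b,
    HasDerivWithinAt (fun s => shear s x a b) (news u x a b) I u
  m_evol : ∀ u ∈ I, ∀ x,
    HasDerivWithinAt (fun s => m s x)
      (-(1 / 8) * normSq2 (news u) x + 1 / 4 * div1 (div2 (news u)) x) I u
  ang_evol : ∀ u ∈ I, ∀ x a,
    HasDerivWithinAt (fun s => ang s x a)
      (grad (m u) x a
        - 1 / 4 * div2 (fun y d a' =>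
            cov1 (div2 (shear u)) y d a' - cov1 (div2 (shear u)) y a' d) x a
        + 1 / 4 * grad (inner2 (shear u) (news u)) x a
        - 1 / 4 * div2 (mul2 (shear u) (news u)) x a
        + 1 / 2 * contr (shear u) (div2 (news u)) x a) I u

variable {I : Set ℝ}

/-- The classical angular momentum
`J̃^k = ∫ ε^{AB} ∇_B X̃^k [N_A - 1/4 C_A^D ∇^B C_{DB}]` at retarded time `u`. -/
def NullInfinityData.angularMomentum (D : NullInfinityData I) (k : Fin 3) (u : ℝ) : ℝ :=
  ∫ x, ∑ a, ∑ b, eps x a b * grad (coordFn k) x b *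
    (D.ang u x a - 1 / 4 * contr (D.shear u) (div2 (D.shear u)) x a) ∂area

/-- The classical center of mass
`C̃^k = ∫ ∇^A X̃^k [N_A - u ∇_A m - 1/4 C_A^D ∇^B C_{DB} - 1/16 ∇_A (C_{DE} C^{DE})]`
at retarded time `u`. -/
def NullInfinityData.centerOfMass (D : NullInfinityData I) (k : Fin 3) (u : ℝ) : ℝ :=
  ∫ x, ∑ a, grad (coordFn k) x a *
    (D.ang u x a - u * grad (D.m u) x a - 1 / 4 * contr (D.shear u) (div2 (D.shear u)) x a
      - 1 / 16 * grad (normSq2 (D.shear u)) x a) ∂area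

end BondiSachs

end

open BondiSachs

/-!
The one-forms `∇X̃^k` and `K_A = ε_A^B ∇_B X̃^k` satisfy `∇_A ∇_B X̃^k = -X̃^k σ_{AB}` and
`∇_A K_B = X̃^k ε_{AB}`. Pairing a divergence `∇^B T_{BA}` with either of them and integrating by
parts therefore leaves `X̃^k` times the trace or the antisymmetric part of `T`, and a gradient
`∇_A f` leaves `2 X̃^k f` or nothing. After differentiation under the integral sign this evaluates
every term of the evolution equations except the flux. Integration by parts itself follows from the
invariance of the area measure under rotations.
-/

noncomputable section

namespace BondiSachs

open scoped Manifold ContDiff Topology RealInnerProductSpace Pointwise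

section Slices

variable {E V : Type*} [NormedAddCommGroup E] [NormedSpace ℝ E] [NormedAddCommGroup V]
  [NormedSpace ℝ V] {I : Set ℝ} {U : Set E} {G : ℝ × E → V} {G' : ℝ × E →L[ℝ] V} {u : ℝ} {y : E}

lemma hasFDerivAt_slice_right (hG : HasFDerivWithinAt G G' (I ×ˢ U) (u, y)) (hU : IsOpen U)
    (hu : u ∈ I) (hy : y ∈ U) :
    HasFDerivAt (fun y => G (u, y)) (G' ∘L ContinuousLinearMap.inr ℝ ℝ E) y := by
  have hmaps : Set.MapsTo (fun z => (u, z)) U (I ×ˢ U) := fun z hz => ⟨hu, hz⟩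
  exact (hG.comp y (hasFDerivAt_prodMk_right u y).hasFDerivWithinAt hmaps).hasFDerivAt
    (hU.mem_nhds hy)

lemma hasDerivWithinAt_slice_left (hG : HasFDerivWithinAt G G' (I ×ˢ U) (u, y)) (hy : y ∈ U) :
    HasDerivWithinAt (fun s => G (s, y)) (G' (1, 0)) I u := by
  have hmaps : Set.MapsTo (fun s => (s, y)) I (I ×ˢ U) := fun s hs => ⟨hs, hy⟩
  simpa [Function.comp_def] using
    (hG.comp u (hasFDerivAt_prodMk_left u y).hasFDerivWithinAt hmaps).hasDerivWithinAt

lemma fderiv_slice_right (hG : DifferentiableWithinAt ℝ G (I ×ˢ U) (u, y)) (hU : IsOpen U)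
    (hu : u ∈ I) (hy : y ∈ U) :
    fderiv ℝ (fun z => G (u, z)) y =
      fderivWithin ℝ G (I ×ˢ U) (u, y) ∘L ContinuousLinearMap.inr ℝ ℝ E :=
  (hasFDerivAt_slice_right hG.hasFDerivWithinAt hU hu hy).fderiv

lemma hasDerivWithinAt_fderiv_slice (hI : Convex ℝ I) (hI' : (interior I).Nonempty)
    (hU : IsOpen U) (hG : ContDiffOn ℝ 2 G (I ×ˢ U)) {g' : ℝ → E → V}
    (hg' : ∀ s ∈ I, ∀ z ∈ U, HasDerivWithinAt (fun s => G (s, z)) (g' s z) I s)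
    (hu : u ∈ I) (hy : y ∈ U) :
    HasDerivWithinAt (fun s => fderiv ℝ (fun z => G (s, z)) y) (fderiv ℝ (g' u) y) I u := by
  have hIU := uniqueDiffOn_convex hI hI'
  have hΩ : UniqueDiffOn ℝ (I ×ˢ U) := hIU.prod hU.uniqueDiffOn
  have hmem : (u, y) ∈ I ×ˢ U := ⟨hu, hy⟩
  have hdiff : DifferentiableOn ℝ G (I ×ˢ U) := hG.differentiableOn two_ne_zero
  have hsymm : IsSymmSndFDerivWithinAt ℝ G (I ×ˢ U) (u, y) := by
    refine (hG _ hmem).isSymmSndFDerivWithinAt (by simp) hΩ ?_ hmem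
    rw [interior_prod_eq, closure_prod_eq, hU.interior_eq,
      hI.closure_interior_eq_closure_of_nonempty_interior hI']
    exact ⟨subset_closure hu, subset_closure hy⟩
  have hD : HasFDerivWithinAt (fderivWithin ℝ G (I ×ˢ U))
      (fderivWithin ℝ (fderivWithin ℝ G (I ×ˢ U)) (I ×ˢ U) (u, y)) (I ×ˢ U) (u, y) :=
    ((hG.fderivWithin (m := 1) hΩ (by norm_num)).differentiableOn one_ne_zero _
      hmem).hasFDerivWithinAt
  have hg'_eq : g' u =ᶠ[𝓝 y] fun z => fderivWithin ℝ G (I ×ˢ U) (u, z) (1, 0) := by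
    filter_upwards [hU.mem_nhds hy] with z hz
    exact (hIU u hu).eq_deriv _ (hg' u hu z hz)
      (hasDerivWithinAt_slice_left (hdiff _ ⟨hu, hz⟩).hasFDerivWithinAt hz)
  have hspace := (hasFDerivAt_slice_right hD hU hu hy).clm_apply
    (hasFDerivAt_const ((1 : ℝ), (0 : E)) y)
  have htime := (hasDerivWithinAt_slice_left hD hy).clm_comp
    (hasDerivWithinAt_const u I (ContinuousLinearMap.inr ℝ ℝ E))
  refine (htime.congr_of_mem (fun s hs => fderiv_slice_right (hdiff _ ⟨hs, hy⟩) hU hs hy)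
    hu).congr_deriv ?_
  rw [hg'_eq.fderiv_eq, hspace.fderiv]
  ext v
  simp [hsymm (1, 0) (0, v)]

end Slices

section IntegralDerivative

variable {X V : Type*} [TopologicalSpace X] [CompactSpace X] [NormedAddCommGroup V] {I : Set ℝ}
  {g g' : ℝ → X → V} {u : ℝ}

lemma exists_bound_near_of_continuousOn
    (hg : ContinuousOn (fun p : ℝ × X => g p.1 p.2) (I ×ˢ Set.univ)) (hu : u ∈ I) :
    ∃ M, ∃ ε > 0, ∀ s ∈ I ∩ Metric.ball u ε, ∀ x, ‖g s x‖ ≤ M := by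
  have hcont : Continuous (g u) := hg.comp_continuous (Continuous.prodMk_right u) fun _ =>
    ⟨hu, trivial⟩
  obtain ⟨M, hM⟩ := isCompact_univ.exists_bound_of_continuousOn hcont.continuousOn
  have hnear : ∀ᶠ s in 𝓝 u, ∀ x ∈ Set.univ, s ∈ I → ‖g s x‖ ≤ M + 1 := by
    refine isCompact_univ.eventually_forall_of_forall_eventually fun x _ => ?_
    have hx := (hg (u, x) ⟨hu, trivial⟩).norm.eventually
      (gt_mem_nhds ((hM x trivial).trans_lt (lt_add_one M)))
    filter_upwards [eventually_nhdsWithin_iff.1 hx] with p hp hpI using (hp ⟨hpI, trivial⟩).le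
  obtain ⟨ε, hε, hball⟩ := Metric.eventually_nhds_iff_ball.1 hnear
  exact ⟨M + 1, ε, hε, fun s hs x => hball s hs.2 x trivial hs.1⟩

lemma hasDerivWithinAt_integral_of_continuousOn [NormedSpace ℝ V] [MeasurableSpace X]
    {μ : Measure X} [IsFiniteMeasure μ] (hI : Convex ℝ I)
    (hg : ∀ s ∈ I, Integrable (g s) μ)
    (hg' : ContinuousOn (fun p : ℝ × X => g' p.1 p.2) (I ×ˢ Set.univ))
    (hderiv : ∀ s ∈ I, ∀ x, HasDerivWithinAt (fun s => g s x) (g' s x) I s) (hu : u ∈ I) :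
    HasDerivWithinAt (fun s => ∫ x, g s x ∂μ) (∫ x, g' u x ∂μ) I u := by
  obtain ⟨M, ε, hε, hM⟩ := exists_bound_near_of_continuousOn hg' hu
  have hlip : ∀ s ∈ I ∩ Metric.ball u ε, ∀ x, ‖g s x - g u x‖ ≤ M * ‖s - u‖ := fun s hs x =>
    Convex.norm_image_sub_le_of_norm_hasDerivWithin_le
      (fun t ht => (hderiv t ht.1 x).mono Set.inter_subset_left) (fun t ht => hM t ht x)
      (hI.inter (convex_ball u ε)) ⟨hu, Metric.mem_ball_self hε⟩ hs
  have hnear : ∀ᶠ s in 𝓝[I \ {u}] u, s ∈ I ∩ Metric.ball u ε ∧ s ≠ u := by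
    filter_upwards [self_mem_nhdsWithin, mem_nhdsWithin_of_mem_nhds (Metric.ball_mem_nhds u hε)]
      with s hs hs' using ⟨⟨hs.1, hs'⟩, hs.2⟩
  have hslope : Filter.Tendsto (fun s => ∫ x, slope (fun s => g s x) u s ∂μ) (𝓝[I \ {u}] u)
      (𝓝 (∫ x, g' u x ∂μ)) := by
    refine tendsto_integral_filter_of_dominated_convergence (fun _ => M) ?_ ?_
      (integrable_const M) (.of_forall fun x =>
        hasDerivWithinAt_iff_tendsto_slope.1 (hderiv u hu x))
    · filter_upwards [hnear] with s hs
      exact (((hg s hs.1.1).sub (hg u hu)).smul (s - u)⁻¹).aestronglyMeasurable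
    · filter_upwards [hnear] with s hs
      refine .of_forall fun x => ?_
      rw [slope_def_module, norm_smul, norm_inv,
        inv_mul_le_iff₀ (norm_pos_iff.2 (sub_ne_zero.2 hs.2)), mul_comm]
      exact hlip s hs.1 x
  refine hasDerivWithinAt_iff_tendsto_slope.2 (hslope.congr' ?_)
  filter_upwards [hnear] with s hs
  simp only [slope_def_module]
  rw [integral_smul, integral_sub (hg s hs.1.1) (hg u hu)]

end IntegralDerivative

section SkewAdjoint

variable {E : Type*} [NormedAddCommGroup E] [InnerProductSpace ℝ E] [CompleteSpace E]
  {A : E →L[ℝ] E} (hA : A ∈ skewAdjoint (E →L[ℝ] E))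

/-- The one-parameter group of linear isometries generated by a skew-adjoint operator. -/
def expIsometry (t : ℝ) : E ≃ₗᵢ[ℝ] E :=
  letI : NormedAlgebra ℚ (E →L[ℝ] E) := .restrictScalars ℚ ℝ _
  Unitary.linearIsometryEquiv ⟨NormedSpace.exp (t • A),
    NormedSpace.exp_mem_unitary_of_mem_skewAdjoint (skewAdjoint.smul_mem t hA)⟩

lemma expIsometry_apply (t : ℝ) (y : E) : expIsometry hA t y = NormedSpace.exp (t • A) y := rfl

lemma expIsometry_zero (y : E) : expIsometry hA 0 y = y := by
  simp [expIsometry_apply]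

lemma hasDerivAt_expIsometry (t : ℝ) (y : E) :
    HasDerivAt (fun t => expIsometry hA t y) (A (expIsometry hA t y)) t := by
  simpa [expIsometry_apply] using
    (hasDerivAt_exp_smul_const' A t).clm_apply (hasDerivAt_const t y)

lemma continuous_expIsometry : Continuous fun p : ℝ × E => expIsometry hA p.1 p.2 := by
  have hexp : Continuous fun t : ℝ => NormedSpace.exp (t • A) :=
    continuous_iff_continuousAt.2 fun t => (hasDerivAt_exp_smul_const' A t).continuousAt
  exact (hexp.comp continuous_fst).clm_apply continuous_snd

/-- The generator `y ↦ ⟪w, y⟫ v - ⟪v, y⟫ w` of the rotations in the plane of `v` and `w`. -/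
def planeRotation (v w : E) : E →L[ℝ] E :=
  (innerSL ℝ w).smulRight v - (innerSL ℝ v).smulRight w

lemma planeRotation_mem_skewAdjoint (v w : E) : planeRotation v w ∈ skewAdjoint (E →L[ℝ] E) := by
  rw [skewAdjoint.mem_iff, ContinuousLinearMap.star_eq_adjoint, eq_comm,
    ContinuousLinearMap.eq_adjoint_iff]
  intro y z
  simp [planeRotation, inner_sub_left, inner_sub_right, real_inner_smul_right,
    real_inner_comm]
  ring

end SkewAdjoint

section SphereMeasure

variable {E : Type*} [NormedAddCommGroup E] [InnerProductSpace ℝ E] [FiniteDimensional ℝ E]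
  [MeasurableSpace E] [BorelSpace E]

/-- The action of a linear isometry on the unit sphere. -/
def sphereMap (φ : E ≃ₗᵢ[ℝ] E) (x : Metric.sphere (0 : E) 1) : Metric.sphere (0 : E) 1 :=
  ⟨φ x, by simp⟩

lemma measurePreserving_sphereMap (φ : E ≃ₗᵢ[ℝ] E) :
    MeasurePreserving (sphereMap φ) (volume : Measure E).toSphere
      (volume : Measure E).toSphere := by
  have hcont : Continuous (sphereMap φ) := by unfold sphereMap; fun_prop
  refine ⟨hcont.measurable, ?_⟩
  ext s hs
  have hcone : Set.Ioo (0 : ℝ) 1 • ((↑) '' (sphereMap φ ⁻¹' s) : Set E)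
      = φ ⁻¹' (Set.Ioo (0 : ℝ) 1 • ((↑) '' s : Set E)) := by
    ext y
    simp only [Set.mem_smul, Set.mem_image, Set.mem_preimage]
    constructor
    · rintro ⟨r, hr, _, ⟨x, hx, rfl⟩, rfl⟩
      exact ⟨r, hr, _, ⟨_, hx, rfl⟩, by simp [sphereMap]⟩
    · rintro ⟨r, hr, _, ⟨x, hx, rfl⟩, hrx⟩
      exact ⟨r, hr, _, ⟨sphereMap φ.symm x, by simpa [sphereMap] using hx, rfl⟩,
        φ.injective (by simpa [sphereMap] using hrx)⟩
  rw [Measure.map_apply hcont.measurable hs,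
    Measure.toSphere_apply' _ (hcont.measurable hs), Measure.toSphere_apply' _ hs, hcone,
    φ.measurePreserving.measure_preimage_emb φ.toHomeomorph.measurableEmbedding]

lemma integral_toSphere_fderiv_skewAdjoint {A : E →L[ℝ] E} (hA : A ∈ skewAdjoint (E →L[ℝ] E))
    {F : E → ℝ} {U : Set E} (hU : IsOpen U) (hsphere : Metric.sphere (0 : E) 1 ⊆ U)
    (hF : ContDiffOn ℝ 1 F U) :
    ∫ x : Metric.sphere (0 : E) 1, fderiv ℝ F x (A x) ∂(volume : Measure E).toSphere = 0 := by
  let φ := expIsometry hA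
  have hφU (t : ℝ) (x : Metric.sphere (0 : E) 1) : φ t x ∈ U := hsphere (sphereMap (φ t) x).2
  have hφ_cont : Continuous fun p : ℝ × Metric.sphere (0 : E) 1 => φ p.1 p.2 :=
    (continuous_expIsometry hA).comp (continuous_fst.prodMk (continuous_subtype_val.comp
      continuous_snd))
  have hF_cont : Continuous fun x : Metric.sphere (0 : E) 1 => F x :=
    hF.continuousOn.comp_continuous continuous_subtype_val fun x => hsphere x.2
  have hderiv (t : ℝ) (x : Metric.sphere (0 : E) 1) :
      HasDerivWithinAt (fun t => F (φ t x)) (fderiv ℝ F (φ t x) (A (φ t x))) Set.univ t :=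
    (((hF.differentiableOn one_ne_zero).differentiableAt
      (hU.mem_nhds (hφU t x))).hasFDerivAt.comp_hasDerivAt t
        (hasDerivAt_expIsometry hA t x)).hasDerivWithinAt
  have hderiv_cont : Continuous fun p : ℝ × Metric.sphere (0 : E) 1 =>
      fderiv ℝ F (φ p.1 p.2) (A (φ p.1 p.2)) :=
    ((hF.continuousOn_fderiv_of_isOpen hU le_rfl).comp_continuous hφ_cont
      fun p => hφU p.1 p.2).clm_apply (A.continuous.comp hφ_cont)
  have hconst (t : ℝ) : ∫ x : Metric.sphere (0 : E) 1, F (φ t x) ∂(volume : Measure E).toSphere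
      = ∫ x : Metric.sphere (0 : E) 1, F x ∂(volume : Measure E).toSphere := by
    have h := measurePreserving_sphereMap (φ t)
    nth_rw 2 [← h.map_eq]
    exact (integral_map h.measurable.aemeasurable hF_cont.aestronglyMeasurable).symm
  have hint (t : ℝ) : Integrable (fun x : Metric.sphere (0 : E) 1 => F (φ t x))
      (volume : Measure E).toSphere :=
    (hF.continuousOn.comp_continuous ((φ t).continuous.comp continuous_subtype_val)
      (hφU t)).integrable_of_hasCompactSupport (.of_compactSpace _)
  have hzero := hasDerivWithinAt_integral_of_continuousOn convex_univ (fun t _ => hint t)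
    hderiv_cont.continuousOn (fun t _ => hderiv t) (Set.mem_univ 0)
  simp only [hconst, hasDerivWithinAt_univ] at hzero
  simpa [φ, expIsometry_zero] using hzero.unique (hasDerivAt_const (0 : ℝ) _)

/-- Summing over an orthonormal basis `e` the integrals of the derivatives of `⟪e i, ·⟫ F` along
the rotations in the planes of `v` and `e i`. -/
lemma integral_toSphere_fderiv_tangential {F : E → ℝ} {U : Set E} (hU : IsOpen U)
    (hsphere : Metric.sphere (0 : E) 1 ⊆ U) (hF : ContDiffOn ℝ 1 F U) (v : E) :
    ∫ x : Metric.sphere (0 : E) 1, (fderiv ℝ F x v - ⟪v, x⟫ * fderiv ℝ F x x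
      - (Module.finrank ℝ E - 1) * (⟪v, x⟫ * F x)) ∂(volume : Measure E).toSphere = 0 := by
  let e := stdOrthonormalBasis ℝ E
  have hG (i) : ContDiffOn ℝ 1 (fun y => ⟪e i, y⟫ * F y) U :=
    (innerSL ℝ (e i)).contDiff.contDiffOn.mul hF
  have hskew (i) := integral_toSphere_fderiv_skewAdjoint (planeRotation_mem_skewAdjoint v (e i)) hU
    hsphere (hG i)
  have hint (i) : Integrable (fun x : Metric.sphere (0 : E) 1 =>
      fderiv ℝ (fun y => ⟪e i, y⟫ * F y) x (planeRotation v (e i) x))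
      (volume : Measure E).toSphere := by
    refine Continuous.integrable_of_hasCompactSupport ?_ (.of_compactSpace _)
    exact (((hG i).continuousOn_fderiv_of_isOpen hU le_rfl).comp_continuous
      continuous_subtype_val fun x => hsphere x.2).clm_apply (by fun_prop)
  rw [← Finset.sum_eq_zero fun i (_ : i ∈ Finset.univ) => hskew i,
    ← integral_finsetSum _ fun i _ => hint i]
  refine integral_congr_ae (.of_forall fun x => ?_)
  have hFx : DifferentiableAt ℝ F x :=
    (hF.differentiableOn one_ne_zero).differentiableAt (hU.mem_nhds (hsphere x.2))
  have hleibniz (i) : fderiv ℝ (fun y => ⟪e i, y⟫ * F y) x (planeRotation v (e i) x)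
      = ⟪e i, x⟫ * ⟪e i, x⟫ * fderiv ℝ F x v - ⟪v, x⟫ * fderiv ℝ F x (⟪e i, x⟫ • e i)
        + F x * (⟪v, e i⟫ * ⟪e i, x⟫) - ⟪v, x⟫ * F x := by
    have hinner : HasFDerivAt (fun y => ⟪e i, y⟫) (innerSL ℝ (e i)) (x : E) :=
      (innerSL ℝ (e i)).hasFDerivAt
    rw [(hinner.fun_mul hFx.hasFDerivAt).fderiv]
    simp [planeRotation, inner_sub_right, real_inner_smul_right, real_inner_comm]
    ring
  have hpars : ∑ i, ⟪e i, (x : E)⟫ * ⟪e i, x⟫ = 1 := by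
    simpa [real_inner_comm] using e.sum_inner_mul_inner (x : E) x
  simp only [hleibniz, Finset.sum_sub_distrib, Finset.sum_add_distrib, ← Finset.sum_mul,
    ← Finset.mul_sum, ← map_sum, e.sum_repr', e.sum_inner_mul_inner, hpars]
  simp
  ring

end SphereMeasure

section Retraction

lemma hasFDerivAt_norm_inv_smul {E : Type*} [NormedAddCommGroup E] [InnerProductSpace ℝ E] {x : E}
    (hx : ‖x‖ = 1) :
    HasFDerivAt (fun y : E => ‖y‖⁻¹ • y)
      (ContinuousLinearMap.id ℝ E - (innerSL ℝ x).smulRight x) x := by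
  have hnorm : HasFDerivAt (fun y : E => ‖y‖) (innerSL ℝ x) x := by
    have h := (hasStrictFDerivAt_norm_sq x).hasFDerivAt.sqrt (by simp [hx])
    simp only [Real.sqrt_sq (norm_nonneg _), hx] at h
    exact h.congr_fderiv (by ext y; simp)
  have hinv : HasFDerivAt (fun y : E => ‖y‖⁻¹) (-innerSL ℝ x) x :=
    ((hasDerivAt_inv (by simp [hx])).comp_hasFDerivAt x hnorm).congr_fderiv (by simp [hx])
  refine (hinv.smul (hasFDerivAt_id x)).congr_fderiv ?_
  ext y
  simp [hx, sub_eq_add_neg]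

lemma coe_ne_zero (x : S2) : (x : E3) ≠ 0 := ne_zero_of_mem_unit_sphere x

lemma coe_retract {y : E3} (hy : y ≠ 0) : (retract y : E3) = ‖y‖⁻¹ • y := by
  simp [retract, hy]

@[simp] lemma retract_coe (x : S2) : retract (x : E3) = x :=
  Subtype.ext (by simp [coe_retract (coe_ne_zero x)])

lemma contDiffOn_coe_retract : ContDiffOn ℝ ∞ (fun y : E3 => (retract y : E3)) {0}ᶜ := by
  have h : ContDiffOn ℝ ∞ (fun y : E3 => ‖y‖⁻¹ • y) {0}ᶜ := fun y (hy : y ≠ 0) =>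
    (((contDiffAt_norm ℝ hy).inv (norm_ne_zero_iff.2 hy)).smul contDiffAt_id).contDiffWithinAt
  exact h.congr fun y hy => coe_retract hy

lemma contMDiffOn_retract : ContMDiffOn 𝓘(ℝ, E3) (𝓡 2) ∞ retract {0}ᶜ := by
  let U : TopologicalSpace.Opens E3 := ⟨{0}ᶜ, isOpen_compl_singleton⟩
  have hcoe : ContMDiff 𝓘(ℝ, E3) 𝓘(ℝ, E3) ∞ (fun y : U => (retract y : E3)) := fun y =>
    contMDiffAt_subtype_iff.2
      (contDiffOn_coe_retract.contMDiffOn.contMDiffAt (U.isOpen.mem_nhds y.2))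
  have hretract := hcoe.codRestrict_sphere (n := 2) fun y => (retract y).2
  exact fun y hy =>
    (contMDiffAt_subtype_iff (x := (⟨y, hy⟩ : U)).1 (hretract ⟨y, hy⟩)).contMDiffWithinAt

lemma hasFDerivAt_coe_retract (x : S2) :
    HasFDerivAt (fun y : E3 => (retract y : E3))
      (ContinuousLinearMap.id ℝ E3 - (innerSL ℝ (x : E3)).smulRight (x : E3)) (x : E3) := by
  refine (hasFDerivAt_norm_inv_smul (norm_eq_of_mem_sphere x)).congr_of_eventuallyEq ?_
  filter_upwards [isOpen_compl_singleton.mem_nhds (coe_ne_zero x)] with y hy using coe_retract hy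

end Retraction

lemma smoothOn_iff {I : Set ℝ} {f : ℝ → S2 → ℝ} :
    SmoothOn I f ↔ ContDiffOn ℝ ∞ (fun p : ℝ × E3 => f p.1 (retract p.2)) (I ×ˢ {0}ᶜ) := by
  constructor
  · intro hf
    have hmap : ContMDiffOn (𝓘(ℝ, ℝ).prod 𝓘(ℝ, E3)) (𝓘(ℝ, ℝ).prod (𝓡 2)) ∞
        (fun p : ℝ × E3 => (p.1, retract p.2)) (I ×ˢ {0}ᶜ) :=
      contMDiffOn_fst.prodMk (contMDiffOn_retract.comp contMDiffOn_snd fun p hp => hp.2)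
    have h := ContMDiffOn.comp hf hmap fun p hp => ⟨hp.1, trivial⟩
    rw [← modelWithCornersSelf_prod, chartedSpaceSelf_prod] at h
    exact h.contDiffOn
  · intro hf
    have hmap : ContMDiff (𝓘(ℝ, ℝ).prod (𝓡 2)) (𝓘(ℝ, ℝ).prod 𝓘(ℝ, E3)) ∞
        (fun p : ℝ × S2 => (p.1, (p.2 : E3))) :=
      contMDiff_fst.prodMk ((contMDiff_coe_sphere (n := 2)).comp contMDiff_snd)
    have h : ContMDiffOn (𝓘(ℝ, ℝ).prod 𝓘(ℝ, E3)) 𝓘(ℝ, ℝ) ∞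
        (fun p : ℝ × E3 => f p.1 (retract p.2)) (I ×ˢ {0}ᶜ) := by
      rw [← modelWithCornersSelf_prod, chartedSpaceSelf_prod]
      exact hf.contMDiffOn
    simpa [SmoothOn, Function.comp_def] using
      h.comp hmap.contMDiffOn fun p hp => ⟨hp.1, coe_ne_zero p.2⟩

/-- Smooth functions on `S²`, viewed as families independent of `u`. -/
abbrev SmoothFn (f : S2 → ℝ) : Prop := SmoothOn Set.univ fun _ => f

namespace SmoothOn

variable {I : Set ℝ} {f g f' : ℝ → S2 → ℝ} {u : ℝ}

lemma add (hf : SmoothOn I f) (hg : SmoothOn I g) : SmoothOn I fun u x => f u x + g u x :=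
  ContMDiffOn.add hf hg

lemma sub (hf : SmoothOn I f) (hg : SmoothOn I g) : SmoothOn I fun u x => f u x - g u x :=
  ContMDiffOn.sub hf hg

lemma mul (hf : SmoothOn I f) (hg : SmoothOn I g) : SmoothOn I fun u x => f u x * g u x :=
  ContMDiffOn.mul hf hg

lemma sum {ι : Type*} {s : Finset ι} {f : ι → ℝ → S2 → ℝ} (hf : ∀ i ∈ s, SmoothOn I (f i)) :
    SmoothOn I fun u x => ∑ i ∈ s, f i u x :=
  contMDiffOn_finsetSum hf

lemma const (c : ℝ) : SmoothOn I fun _ _ => c := contMDiffOn_const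

lemma slice (hf : SmoothOn I f) (hu : u ∈ I) : SmoothFn (f u) :=
  ContMDiffOn.comp (g := fun p : ℝ × S2 => f p.1 p.2) hf
    (contMDiff_const.prodMk contMDiff_snd).contMDiffOn fun _ _ => ⟨hu, trivial⟩

lemma continuousOn (hf : SmoothOn I f) :
    ContinuousOn (fun p : ℝ × S2 => f p.1 p.2) (I ×ˢ Set.univ) :=
  ContMDiffOn.continuousOn hf

lemma differentiableWithinAt (hf : SmoothOn I f) (hu : u ∈ I) {y : E3} (hy : y ≠ 0) :
    DifferentiableWithinAt ℝ (fun p : ℝ × E3 => f p.1 (retract p.2)) (I ×ˢ {0}ᶜ) (u, y) :=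
  (smoothOn_iff.1 hf).differentiableOn (by simp) (u, y) ⟨hu, hy⟩

lemma fderivWithin_apply (hI : UniqueDiffOn ℝ I) (hf : SmoothOn I f) (v : ℝ × E3) :
    SmoothOn I fun u x => fderivWithin ℝ (fun p : ℝ × E3 => f p.1 (retract p.2)) (I ×ˢ {0}ᶜ)
      (u, (x : E3)) v := by
  have hfderiv := (smoothOn_iff.1 hf).fderivWithin (m := ∞)
    (hI.prod isOpen_compl_singleton.uniqueDiffOn) (by simp)
  have hmap : ContDiffOn ℝ ∞ (fun p : ℝ × E3 => (p.1, (retract p.2 : E3))) (I ×ˢ {0}ᶜ) :=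
    contDiffOn_fst.prodMk (contDiffOn_coe_retract.comp contDiffOn_snd fun p hp => hp.2)
  exact smoothOn_iff.2 ((hfderiv.comp hmap fun p hp => ⟨hp.1, coe_ne_zero _⟩).clm_apply
    contDiffOn_const)

lemma congr (hf : SmoothOn I f) (hfg : ∀ u ∈ I, ∀ x, g u x = f u x) : SmoothOn I g :=
  ContMDiffOn.congr hf fun p hp => hfg p.1 hp.1 p.2

lemma grad (hI : UniqueDiffOn ℝ I) (hf : SmoothOn I f) (a : Fin 3) :
    SmoothOn I fun u x => grad (f u) x a := by
  refine (hf.fderivWithin_apply hI (0, EuclideanSpace.single a 1)).congr fun u hu x => ?_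
  have h := fderiv_slice_right (hf.differentiableWithinAt hu (coe_ne_zero x))
    isOpen_compl_singleton hu (coe_ne_zero x)
  simp only at h
  simp [BondiSachs.grad, h]

lemma of_hasDerivWithinAt (hI : UniqueDiffOn ℝ I) (hf : SmoothOn I f)
    (hf' : ∀ u ∈ I, ∀ x, HasDerivWithinAt (fun s => f s x) (f' u x) I u) : SmoothOn I f' := by
  refine (hf.fderivWithin_apply hI (1, 0)).congr fun u hu x => ?_
  have h := hasDerivWithinAt_slice_left
    (hf.differentiableWithinAt hu (coe_ne_zero x)).hasFDerivWithinAt (coe_ne_zero x)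
  simp only [retract_coe] at h
  exact (hI u hu).eq_deriv _ (hf' u hu x) h

lemma hasDerivWithinAt_grad (hI : Convex ℝ I) (hI' : (interior I).Nonempty) (hf : SmoothOn I f)
    (hf' : ∀ u ∈ I, ∀ x, HasDerivWithinAt (fun s => f s x) (f' u x) I u) (hu : u ∈ I) (x : S2)
    (a : Fin 3) :
    HasDerivWithinAt (fun s => BondiSachs.grad (f s) x a) (BondiSachs.grad (f' u) x a) I u := by
  have h := hasDerivWithinAt_fderiv_slice hI hI' isOpen_compl_singleton
    (contDiffOn_infty.1 (smoothOn_iff.1 hf) 2) (fun s hs z _ => hf' s hs (retract z)) hu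
    (coe_ne_zero x)
  simpa [BondiSachs.grad] using h.clm_apply (hasDerivWithinAt_const u I (EuclideanSpace.single a 1))

end SmoothOn

instance : IsFiniteMeasure area := inferInstanceAs (IsFiniteMeasure (volume : Measure E3).toSphere)

namespace SmoothFn

variable {f : S2 → ℝ}

lemma family (hf : SmoothFn f) (I : Set ℝ) : SmoothOn I fun _ => f :=
  ContMDiffOn.mono hf (Set.prod_mono_left (Set.subset_univ I))

lemma continuous (hf : SmoothFn f) : Continuous f :=
  hf.continuousOn.comp_continuous (Continuous.prodMk_right 0) fun _ => ⟨trivial, trivial⟩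

lemma contDiffOn (hf : SmoothFn f) : ContDiffOn ℝ ∞ (fun y : E3 => f (retract y)) {0}ᶜ :=
  (smoothOn_iff.1 hf).comp (contDiff_prodMk_right (0 : ℝ)).contDiffOn fun _ hy => ⟨trivial, hy⟩

lemma differentiableAt (hf : SmoothFn f) (x : S2) :
    DifferentiableAt ℝ (fun y : E3 => f (retract y)) x :=
  (hf.contDiffOn.contDiffAt (isOpen_compl_singleton.mem_nhds (coe_ne_zero x))).differentiableAt
    (by simp)

lemma integrable (hf : SmoothFn f) : Integrable f area :=
  hf.continuous.integrable_of_hasCompactSupport (.of_compactSpace f)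

end SmoothFn

lemma SmoothOn.hasDerivWithinAt_integral {I : Set ℝ} {f f' : ℝ → S2 → ℝ} {u : ℝ} (hI : Convex ℝ I)
    (hI' : (interior I).Nonempty) (hf : SmoothOn I f)
    (hf' : ∀ u ∈ I, ∀ x, HasDerivWithinAt (fun s => f s x) (f' u x) I u) (hu : u ∈ I) :
    HasDerivWithinAt (fun s => ∫ x, f s x ∂area) (∫ x, f' u x ∂area) I u :=
  hasDerivWithinAt_integral_of_continuousOn hI (fun _ hs => (hf.slice hs).integrable)
    (hf.of_hasDerivWithinAt (uniqueDiffOn_convex hI hI') hf').continuousOn hf' hu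

lemma grad_mul {f g : S2 → ℝ} (hf : SmoothFn f) (hg : SmoothFn g) (x : S2) (a : Fin 3) :
    grad (fun x => f x * g x) x a = f x * grad g x a + g x * grad f x a := by
  simp [grad, fderiv_fun_mul (hf.differentiableAt x) (hg.differentiableAt x)]

lemma grad_sum {ι : Type*} {s : Finset ι} {f : ι → S2 → ℝ} (hf : ∀ i ∈ s, SmoothFn (f i))
    (x : S2) (a : Fin 3) :
    grad (fun x => ∑ i ∈ s, f i x) x a = ∑ i ∈ s, grad (f i) x a := by
  simp [grad, fderiv_fun_sum fun i hi => (hf i hi).differentiableAt x]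

lemma grad_coordFn (k : Fin 3) (x : S2) (a : Fin 3) : grad (coordFn k) x a = sigma x k a := by
  have h : HasFDerivAt (fun y : E3 => coordFn k (retract y)) _ (x : E3) :=
    (EuclideanSpace.proj k : E3 →L[ℝ] ℝ).hasFDerivAt.comp _ (hasFDerivAt_coe_retract x)
  rw [grad, h.fderiv]
  simp [sigma, EuclideanSpace.inner_single_right, mul_comm]

lemma smoothFn_coordFn (k : Fin 3) : SmoothFn (coordFn k) := by
  refine smoothOn_iff.2 ((EuclideanSpace.proj k : E3 →L[ℝ] ℝ).contDiff.comp_contDiffOn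
    (contDiffOn_coe_retract.comp contDiffOn_snd fun p hp => hp.2))

/-- `f ∘ retract` is unchanged by precomposition with `retract`, whose derivative at `x` kills
`x`. -/
lemma fderiv_comp_retract_self {f : S2 → ℝ} (hf : SmoothFn f) (x : S2) :
    fderiv ℝ (fun y : E3 => f (retract y)) x x = 0 := by
  have hx : HasFDerivAt (fun y : E3 => f (retract y)) (fderiv ℝ (fun y => f (retract y)) x)
      (retract (x : E3) : E3) := by
    simpa using (hf.differentiableAt x).hasFDerivAt
  have hcomp := hx.comp (x : E3) (hasFDerivAt_coe_retract x)
  simp only [Function.comp_def, retract_coe] at hcomp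
  rw [hcomp.fderiv]
  simp

lemma fderiv_comp_retract_apply (f : S2 → ℝ) (x : S2) (v : E3) :
    fderiv ℝ (fun y : E3 => f (retract y)) x v = ∑ a, v a * grad f x a := by
  have hv : v = ∑ a, v a • EuclideanSpace.single a (1 : ℝ) := by
    ext k
    simp [Finset.sum_apply, Pi.single_apply]
  conv_lhs => rw [hv]
  simp [grad]

lemma sum_coord_mul_grad {f : S2 → ℝ} (hf : SmoothFn f) (x : S2) :
    ∑ a, (x : E3) a * grad f x a = 0 := by
  rw [← fderiv_comp_retract_apply, fderiv_comp_retract_self hf]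

lemma integral_grad {f : S2 → ℝ} (hf : SmoothFn f) (a : Fin 3) :
    ∫ x, grad f x a ∂area = 2 * ∫ x, coordFn a x * f x ∂area := by
  have h := integral_toSphere_fderiv_tangential isOpen_compl_singleton
    (fun x hx => coe_ne_zero ⟨x, hx⟩) (hf.contDiffOn.of_le (by simp)) (EuclideanSpace.single a 1)
  have hint : Integrable (fun x => 2 * (coordFn a x * f x)) area :=
    (SmoothFn.integrable ((smoothFn_coordFn a).mul hf)).const_mul 2
  rw [← integral_const_mul, ← sub_eq_zero,
    ← integral_sub (SmoothFn.integrable (hf.grad uniqueDiffOn_univ a)) hint, ← h]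
  refine integral_congr_ae (.of_forall fun x => ?_)
  simp only [fderiv_comp_retract_self hf, grad, coordFn, EuclideanSpace.inner_single_left,
    finrank_euclideanSpace_fin, retract_coe]
  norm_num

section FrameAlgebra

lemma sum_coord_sq (x : S2) : ∑ a, (x : E3) a * (x : E3) a = 1 := by
  have h := EuclideanSpace.real_norm_sq_eq (x : E3)
  simp only [norm_eq_of_mem_sphere, one_pow] at h
  simp only [← sq, ← h]

lemma sigma_comm (x : S2) (a b : Fin 3) : sigma x a b = sigma x b a := by
  simp only [sigma, eq_comm (a := a), mul_comm]

lemma sum_sigma_mul (x : S2) (v : Fin 3 → ℝ) (a : Fin 3) :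
    ∑ b, sigma x a b * v b = v a - (x : E3) a * ∑ b, (x : E3) b * v b := by
  simp [sigma, sub_mul, Finset.sum_sub_distrib, Finset.mul_sum, mul_assoc]

lemma sum_sigma_mul_of_tangent {x : S2} {v : Fin 3 → ℝ} (hv : ∑ b, (x : E3) b * v b = 0)
    (a : Fin 3) : ∑ b, sigma x a b * v b = v a := by
  rw [sum_sigma_mul, hv, mul_zero, sub_zero]

lemma sum_coord_mul_sigma (x : S2) (a : Fin 3) : ∑ b, (x : E3) b * sigma x b a = 0 := by
  have h := sum_sigma_mul x (fun b => (x : E3) b) a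
  rw [sum_coord_sq, mul_one, sub_self] at h
  simpa only [mul_comm, sigma_comm x a] using h

lemma sum_sigma_self (x : S2) : ∑ a, sigma x a a = 2 := by
  simp only [sigma, if_true, Finset.sum_sub_distrib, sum_coord_sq]
  norm_num

lemma sum_coord_mul_eps (x : S2) (a : Fin 3) : ∑ b, (x : E3) b * eps x b a = 0 := by
  fin_cases a <;> simp [eps, Fin.sum_univ_three] <;> ring

lemma eps_antisymm (x : S2) (a b : Fin 3) : eps x a b = -eps x b a := by
  fin_cases a <;> fin_cases b <;> simp [eps]

lemma sum_coord_mul_eps_right (x : S2) (a : Fin 3) : ∑ b, (x : E3) b * eps x a b = 0 := by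
  simp only [eps_antisymm x a, mul_neg, Finset.sum_neg_distrib, sum_coord_mul_eps, neg_zero]

lemma smoothFn_sigma (a b : Fin 3) : SmoothFn fun x => sigma x a b :=
  (SmoothOn.const _).sub ((smoothFn_coordFn a).mul (smoothFn_coordFn b))

lemma smoothFn_eps (a b : Fin 3) : SmoothFn fun x => eps x a b := by
  have hX := smoothFn_coordFn
  have hneg (k : Fin 3) : SmoothFn fun x => -coordFn k x := ContMDiffOn.neg (hX k)
  have h0 : SmoothFn fun _ => 0 := SmoothOn.const 0
  fin_cases a <;> fin_cases b
  exacts [h0, hX 2, hneg 1, hneg 2, h0, hX 0, hX 1, hneg 0, h0]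

lemma grad_sigma (x : S2) (a b c : Fin 3) :
    grad (fun x => sigma x a b) x c
      = -(coordFn a x * sigma x b c + coordFn b x * sigma x a c) := by
  have h := grad_mul (smoothFn_coordFn a) (smoothFn_coordFn b) x c
  simp only [grad_coordFn] at h
  rw [← h]
  simp [grad, sigma, coordFn, fderiv_const_sub]

lemma grad_eps (x : S2) (a b c : Fin 3) :
    grad (fun x => eps x a b) x c
      = (![![0, sigma x 2 c, -sigma x 1 c],
          ![-sigma x 2 c, 0, sigma x 0 c],
          ![sigma x 1 c, -sigma x 0 c, 0]] : Matrix (Fin 3) (Fin 3) ℝ) a b := by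
  have hX (k : Fin 3) : grad (fun x : S2 => (x : E3) k) x c = sigma x k c := grad_coordFn k x c
  have hneg (k : Fin 3) : grad (fun x : S2 => -(x : E3) k) x c = -sigma x k c := by
    simp only [← hX, grad, fderiv_fun_neg, neg_apply]
  have h0 : grad (fun _ => 0) x c = 0 := by simp [grad]
  fin_cases a <;> fin_cases b
  exacts [h0, hX 2, hneg 1, hneg 2, h0, hX 0, hX 1, hneg 0, h0]

lemma sum_grad_eps (x : S2) (b : Fin 3) : ∑ a, grad (fun x => eps x a b) x a = 0 := by
  simp only [grad_eps, Fin.sum_univ_three]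
  fin_cases b <;> simp [sigma] <;> ring

end FrameAlgebra

section Tensors

/-- Smooth one-forms on `S²`, viewed as families independent of `u`. -/
abbrev SmoothForm (w : OneForm) : Prop := IsSmoothOneForm Set.univ fun _ => w

/-- A smooth two-tensor on `S²`, of arbitrary symmetry, depending smoothly on `u ∈ I`; both slots
are required to be tangential. -/
structure IsSmoothTwoTensor (I : Set ℝ) (T : ℝ → TwoTensor) : Prop where
  smooth : ∀ a b, SmoothOn I fun u x => T u x a b
  tangent_left : ∀ u ∈ I, ∀ (x : S2) (b : Fin 3), ∑ a, (x : E3) a * T u x a b = 0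
  tangent_right : ∀ u ∈ I, ∀ (x : S2) (a : Fin 3), ∑ b, (x : E3) b * T u x a b = 0

/-- Smooth two-tensors on `S²`, viewed as families independent of `u`. -/
abbrev SmoothTensor (T : TwoTensor) : Prop := IsSmoothTwoTensor Set.univ fun _ => T

/-- The pairing `Z^a w_a` of one-forms. -/
def dot (Z w : OneForm) (x : S2) : ℝ := ∑ a, Z x a * w x a

/-- The exterior derivative `∇_d w_a - ∇_a w_d` of a one-form. -/
def curl (w : OneForm) : TwoTensor := fun x d a => cov1 w x d a - cov1 w x a d

variable {I : Set ℝ} {u : ℝ} {f : ℝ → S2 → ℝ} {v w Z : ℝ → OneForm} {S T : ℝ → TwoTensor}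

lemma SmoothOn.isSmoothOneForm_grad (hI : UniqueDiffOn ℝ I) (hf : SmoothOn I f) :
    IsSmoothOneForm I fun u => BondiSachs.grad (f u) :=
  ⟨hf.grad hI, fun _ hu => sum_coord_mul_grad (hf.slice hu)⟩

namespace IsSmoothOneForm

lemma slice (hw : IsSmoothOneForm I w) (hu : u ∈ I) : SmoothForm (w u) :=
  ⟨fun a => (hw.smooth a).slice hu, fun _ _ => hw.tangent u hu⟩

lemma add (hw : IsSmoothOneForm I w) (hv : IsSmoothOneForm I v) :
    IsSmoothOneForm I fun u => w u + v u :=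
  ⟨fun a => (hw.smooth a).add (hv.smooth a), fun u hu x => by
    simp [mul_add, Finset.sum_add_distrib, hw.tangent u hu, hv.tangent u hu]⟩

lemma sub (hw : IsSmoothOneForm I w) (hv : IsSmoothOneForm I v) :
    IsSmoothOneForm I fun u => w u - v u :=
  ⟨fun a => (hw.smooth a).sub (hv.smooth a), fun u hu x => by
    simp [mul_sub, Finset.sum_sub_distrib, hw.tangent u hu, hv.tangent u hu]⟩

lemma const_smul (hw : IsSmoothOneForm I w) (c : ℝ) : IsSmoothOneForm I fun u => c • w u :=
  ⟨fun a => (SmoothOn.const c).mul (hw.smooth a), fun u hu x => by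
    simp [mul_left_comm _ c, ← Finset.mul_sum, hw.tangent u hu]⟩

lemma smoothOn_dot (hZ : IsSmoothOneForm I Z) (hw : IsSmoothOneForm I w) :
    SmoothOn I fun u => dot (Z u) (w u) :=
  .sum fun a _ => (hZ.smooth a).mul (hw.smooth a)

lemma cov1 (hI : UniqueDiffOn ℝ I) (hw : IsSmoothOneForm I w) :
    IsSmoothTwoTensor I fun u => cov1 (w u) where
  smooth a b := .sum fun c _ => ((smoothFn_sigma b c).family I).mul ((hw.smooth c).grad hI a)
  tangent_left u hu x b := by
    have h (c) := sum_coord_mul_grad ((hw.smooth c).slice hu) x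
    simp only [BondiSachs.cov1, Finset.mul_sum, mul_left_comm _ (sigma x b _)]
    rw [Finset.sum_comm]
    simp only [← Finset.mul_sum, h, mul_zero, Finset.sum_const_zero]
  tangent_right u _ x a := by
    simp only [BondiSachs.cov1, Finset.mul_sum, ← mul_assoc]
    rw [Finset.sum_comm]
    simp only [← Finset.sum_mul, sum_coord_mul_sigma, zero_mul, Finset.sum_const_zero]

lemma smoothOn_div1 (hI : UniqueDiffOn ℝ I) (hw : IsSmoothOneForm I w) :
    SmoothOn I fun u => div1 (w u) :=
  .sum fun a _ => (hw.cov1 hI).smooth a a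

lemma curl (hI : UniqueDiffOn ℝ I) (hw : IsSmoothOneForm I w) :
    IsSmoothTwoTensor I fun u => curl (w u) := by
  have h := hw.cov1 hI
  refine ⟨fun a b => (h.smooth a b).sub (h.smooth b a), fun u hu x b => ?_, fun u hu x a => ?_⟩ <;>
    simp only [BondiSachs.curl, mul_sub, Finset.sum_sub_distrib, h.tangent_left u hu,
      h.tangent_right u hu, sub_zero]

end IsSmoothOneForm

lemma div2_eq_sum_sigma_mul_div1 (T : TwoTensor) (x : S2) (b : Fin 3) :
    div2 T x b = ∑ c, sigma x b c * div1 (fun y a => T y a c) x := by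
  simp only [div2, cov2, div1, cov1, Finset.mul_sum]
  rw [Finset.sum_congr rfl fun a _ => Finset.sum_comm, Finset.sum_comm]
  exact Finset.sum_congr rfl fun c _ => Finset.sum_congr rfl fun a _ =>
    Finset.sum_congr rfl fun a' _ => by ring

namespace IsSmoothTwoTensor

lemma slice (hT : IsSmoothTwoTensor I T) (hu : u ∈ I) : SmoothTensor (T u) :=
  ⟨fun a b => (hT.smooth a b).slice hu, fun _ _ => hT.tangent_left u hu,
    fun _ _ => hT.tangent_right u hu⟩

lemma contr (hT : IsSmoothTwoTensor I T) (hw : IsSmoothOneForm I w) :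
    IsSmoothOneForm I fun u => contr (T u) (w u) where
  smooth a := .sum fun d _ => (hT.smooth a d).mul (hw.smooth d)
  tangent u hu x := by
    simp only [BondiSachs.contr, Finset.mul_sum, ← mul_assoc]
    rw [Finset.sum_comm]
    simp only [← Finset.sum_mul, hT.tangent_left u hu, zero_mul, Finset.sum_const_zero]

lemma mul2 (hS : IsSmoothTwoTensor I S) (hT : IsSmoothTwoTensor I T) :
    IsSmoothTwoTensor I fun u => mul2 (S u) (T u) where
  smooth a b := .sum fun d _ => (hS.smooth a d).mul (hT.smooth d b)
  tangent_left u hu x b := by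
    simp only [BondiSachs.mul2, Finset.mul_sum, ← mul_assoc]
    rw [Finset.sum_comm]
    simp only [← Finset.sum_mul, hS.tangent_left u hu, zero_mul, Finset.sum_const_zero]
  tangent_right u hu x a := by
    simp only [BondiSachs.mul2, Finset.mul_sum, mul_left_comm _ (S u x a _)]
    rw [Finset.sum_comm]
    simp only [← Finset.mul_sum, hT.tangent_right u hu, mul_zero, Finset.sum_const_zero]

lemma smoothOn_inner2 (hS : IsSmoothTwoTensor I S) (hT : IsSmoothTwoTensor I T) :
    SmoothOn I fun u => inner2 (S u) (T u) :=
  .sum fun a _ => .sum fun b _ => (hS.smooth a b).mul (hT.smooth a b)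

lemma div2 (hI : UniqueDiffOn ℝ I) (hT : IsSmoothTwoTensor I T) :
    IsSmoothOneForm I fun u => div2 (T u) where
  smooth b := .sum fun a _ => .sum fun a' _ => .sum fun b' _ =>
    (((smoothFn_sigma a a').family I).mul ((smoothFn_sigma b b').family I)).mul
      ((hT.smooth a' b').grad hI a)
  tangent u _ x := by
    simp only [div2_eq_sum_sigma_mul_div1, Finset.mul_sum]
    rw [Finset.sum_comm]
    simp only [← mul_assoc, ← Finset.sum_mul, sum_coord_mul_sigma, zero_mul, Finset.sum_const_zero]

end IsSmoothTwoTensor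

lemma IsSmoothSymTraceless.isSmoothTwoTensor (hT : IsSmoothSymTraceless I T) :
    IsSmoothTwoTensor I T :=
  ⟨hT.smooth, hT.tangent, fun u hu x a => by
    simpa only [hT.symm u hu x a] using hT.tangent u hu x a⟩

lemma smoothTensor_eps : SmoothTensor eps :=
  ⟨smoothFn_eps, fun _ _ => sum_coord_mul_eps, fun _ _ => sum_coord_mul_eps_right⟩

end Tensors

section TensorCalculus

variable {f : S2 → ℝ} {w Z : OneForm} {T : TwoTensor}

lemma sum_sigma_mul_grad (hf : SmoothFn f) (x : S2) (a : Fin 3) :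
    ∑ b, sigma x a b * grad f x b = grad f x a :=
  sum_sigma_mul_of_tangent (sum_coord_mul_grad hf x) a

lemma div1_eq_sum_grad (hw : ∀ a, SmoothFn fun x => w x a) (x : S2) :
    div1 w x = ∑ a, grad (fun x => w x a) x a := by
  simp only [div1, cov1]
  rw [Finset.sum_comm]
  simp only [sigma_comm x _, sum_sigma_mul_grad (hw _)]

lemma dot_comm (w v : OneForm) (x : S2) : dot w v x = dot v w x := by
  simp only [dot, mul_comm]

lemma inner2_comm (S T : TwoTensor) (x : S2) : inner2 S T x = inner2 T S x := by
  simp only [inner2, mul_comm]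

lemma dot_div2 (hZ : SmoothForm Z) (T : TwoTensor) (x : S2) :
    dot Z (div2 T) x = ∑ c, Z x c * div1 (fun y a => T y a c) x := by
  simp only [dot, div2_eq_sum_sigma_mul_div1, Finset.mul_sum, ← mul_assoc]
  rw [Finset.sum_comm]
  simp only [← Finset.sum_mul, mul_comm (Z x _), sigma_comm x _ _]
  exact Finset.sum_congr rfl fun c _ => by
    rw [sum_sigma_mul_of_tangent (hZ.tangent 0 trivial x), mul_comm]

lemma inner2_cov1 (hT : SmoothTensor T) (w : OneForm) (x : S2) :
    inner2 T (cov1 w) x = ∑ a, ∑ b, T x a b * grad (fun y => w y b) x a := by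
  simp only [inner2, cov1, Finset.mul_sum, ← mul_assoc]
  refine Finset.sum_congr rfl fun a _ => ?_
  rw [Finset.sum_comm]
  simp only [← Finset.sum_mul, mul_comm (T x a _), sigma_comm x _]
  exact Finset.sum_congr rfl fun b _ => by
    rw [sum_sigma_mul_of_tangent (hT.tangent_right 0 trivial x a), mul_comm]

lemma div1_contr (hT : SmoothTensor T) (hZ : SmoothForm Z) (x : S2) :
    div1 (contr T Z) x = dot Z (div2 T) x + inner2 T (cov1 Z) x := by
  have hcontr (a) : grad (fun x => contr T Z x a) x a = ∑ b,
      (Z x b * grad (fun x => T x a b) x a + T x a b * grad (fun x => Z x b) x a) := by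
    simp only [contr, grad_sum fun b _ => (hT.smooth a b).mul (hZ.smooth b),
      grad_mul (hT.smooth a _) (hZ.smooth _), add_comm]
  rw [div1_eq_sum_grad (hT.contr hZ).smooth, dot_div2 hZ, inner2_cov1 hT]
  simp only [hcontr, div1_eq_sum_grad fun a => hT.smooth a _, Finset.sum_add_distrib,
    Finset.mul_sum]
  rw [Finset.sum_comm]

lemma div1_mul (hf : SmoothFn f) (hw : SmoothForm w) (x : S2) :
    div1 (fun x a => f x * w x a) x = f x * div1 w x + dot w (grad f) x := by
  have hfw (a) : SmoothFn fun x => f x * w x a := SmoothOn.mul hf (hw.smooth a)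
  simp only [div1_eq_sum_grad hw.smooth, div1_eq_sum_grad hfw, grad_mul hf (hw.smooth _),
    Finset.sum_add_distrib, Finset.mul_sum, dot]

lemma sum_eps_mul_sigma (x : S2) (a k : Fin 3) : ∑ b, eps x a b * sigma x k b = eps x a k := by
  simpa only [mul_comm] using sum_sigma_mul_of_tangent (sum_coord_mul_eps_right x a) k

lemma div2_eps (x : S2) (b : Fin 3) : div2 eps x b = 0 := by
  simp only [div2_eq_sum_sigma_mul_div1, div1_eq_sum_grad fun a => smoothFn_eps a _, sum_grad_eps,
    mul_zero, Finset.sum_const_zero]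

lemma dot_contr_eps (w v : OneForm) (x : S2) : dot (contr eps w) v x = -dot w (contr eps v) x := by
  simp only [dot, contr, Finset.sum_mul, Finset.mul_sum, ← Finset.sum_neg_distrib]
  rw [Finset.sum_comm]
  refine Finset.sum_congr rfl fun b _ => Finset.sum_congr rfl fun a _ => ?_
  rw [eps_antisymm x a b]
  ring

lemma inner2_eps_of_symm (hT : ∀ x a b, T x a b = T x b a) (x : S2) : inner2 T eps x = 0 := by
  have h : inner2 T eps x = -inner2 T eps x := by
    conv_lhs => rw [inner2, Finset.sum_comm]
    simp only [inner2, ← Finset.sum_neg_distrib, ← mul_neg, ← eps_antisymm x, hT x]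
  linarith

lemma inner2_curl_eps (w : OneForm) (x : S2) :
    inner2 (curl w) eps x = 2 * inner2 eps (cov1 w) x := by
  have hswap : ∑ a, ∑ b, eps x a b * cov1 w x b a = -inner2 eps (cov1 w) x := by
    rw [Finset.sum_comm]
    simp only [inner2, ← Finset.sum_neg_distrib, ← neg_mul, ← eps_antisymm x]
  rw [inner2_comm]
  simp only [inner2, curl, mul_sub, Finset.sum_sub_distrib, hswap]
  rw [← inner2]
  ring

lemma sum_curl_self (w : OneForm) (x : S2) : ∑ a, curl w x a a = 0 := by
  simp only [curl, sub_self, Finset.sum_const_zero]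

lemma sum_mul2_self (S : TwoTensor) (hT : ∀ x a b, T x a b = T x b a) (x : S2) :
    ∑ a, mul2 S T x a a = inner2 S T x := by
  simp only [mul2, inner2, hT x]

end TensorCalculus

section KillingForms

/-- The rotation field `ε_a^b ∇_b X^k` about the `k`-th axis, as a one-form. -/
def killing (k : Fin 3) : OneForm := contr eps (grad (coordFn k))

lemma smoothForm_grad_coordFn (k : Fin 3) : SmoothForm (grad (coordFn k)) :=
  (smoothFn_coordFn k).isSmoothOneForm_grad uniqueDiffOn_univ

lemma smoothForm_killing (k : Fin 3) : SmoothForm (killing k) :=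
  smoothTensor_eps.contr (smoothForm_grad_coordFn k)

lemma killing_apply (k : Fin 3) (x : S2) (a : Fin 3) : killing k x a = eps x a k := by
  simp only [killing, contr, grad_coordFn, sum_eps_mul_sigma]

lemma cov1_grad_coordFn (k : Fin 3) (x : S2) (a b : Fin 3) :
    cov1 (grad (coordFn k)) x a b = -(coordFn k x * sigma x a b) := by
  have hX := sum_coord_mul_sigma x b
  have hσ := sum_sigma_mul_of_tangent (sum_coord_mul_sigma x a) b
  simp only [cov1, grad_coordFn, grad_sigma]
  calc ∑ c, sigma x b c * -(coordFn k x * sigma x c a + coordFn c x * sigma x k a)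
      = -(coordFn k x * ∑ c, sigma x b c * sigma x c a)
        - (∑ c, (x : E3) c * sigma x c b) * sigma x k a := by
        simp only [Finset.mul_sum, Finset.sum_mul, ← Finset.sum_neg_distrib,
          ← Finset.sum_sub_distrib]
        refine Finset.sum_congr rfl fun c _ => ?_
        rw [sigma_comm x c b, coordFn, coordFn]
        ring
    _ = -(coordFn k x * sigma x a b) := by rw [hσ, hX, zero_mul, sub_zero, sigma_comm x b a]

lemma cov1_killing (k : Fin 3) (x : S2) (a b : Fin 3) :
    cov1 (killing k) x a b = coordFn k x * eps x a b := by
  have hX := sum_coord_sq x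
  simp only [Fin.sum_univ_three] at hX
  simp only [cov1, killing_apply, grad_eps, coordFn, Fin.sum_univ_three]
  fin_cases k <;> fin_cases a <;> fin_cases b <;> simp only [sigma, eps, Fin.isValue,
      Fin.zero_eta, Fin.mk_one, Fin.reduceFinMk, Fin.reduceEq, if_true, if_false, zero_ne_one,
      one_ne_zero, Matrix.cons_val', Matrix.cons_val_zero, Matrix.cons_val_fin_one,
      Matrix.cons_val_one, Matrix.cons_val] <;>
    first | ring1 | linear_combination hX | linear_combination -hX

end KillingForms

section IntegralIdentities

variable {f : S2 → ℝ} {v w Z : OneForm} {T : TwoTensor}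

/-- The `L²` pairing `∫ Z^a w_a` of one-forms on `S²`. -/
def pairing (Z w : OneForm) : ℝ := ∫ x, dot Z w x ∂area

lemma integrable_dot (hZ : SmoothForm Z) (hw : SmoothForm w) :
    Integrable (fun x => dot Z w x) area :=
  SmoothFn.integrable (hZ.smoothOn_dot hw)

lemma pairing_comm (Z w : OneForm) : pairing Z w = pairing w Z := by
  simp only [pairing, dot_comm Z w]

lemma pairing_add (hZ : SmoothForm Z) (hv : SmoothForm v) (hw : SmoothForm w) :
    pairing Z (v + w) = pairing Z v + pairing Z w := by
  rw [pairing, pairing, pairing, ← integral_add (integrable_dot hZ hv) (integrable_dot hZ hw)]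
  simp only [dot, Pi.add_apply, mul_add, Finset.sum_add_distrib]

lemma pairing_sub (hZ : SmoothForm Z) (hv : SmoothForm v) (hw : SmoothForm w) :
    pairing Z (v - w) = pairing Z v - pairing Z w := by
  rw [pairing, pairing, pairing, ← integral_sub (integrable_dot hZ hv) (integrable_dot hZ hw)]
  simp only [dot, Pi.sub_apply, mul_sub, Finset.sum_sub_distrib]

lemma pairing_smul (c : ℝ) (Z w : OneForm) : pairing Z (c • w) = c * pairing Z w := by
  simp only [pairing, dot, Pi.smul_apply, smul_eq_mul, mul_left_comm _ c, ← Finset.mul_sum,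
    integral_const_mul]

lemma integral_div1 (hw : SmoothForm w) : ∫ x, div1 w x ∂area = 0 := by
  have hint (a) : Integrable (fun x => grad (fun x => w x a) x a) area :=
    SmoothFn.integrable (SmoothOn.grad uniqueDiffOn_univ (hw.smooth a) a)
  simp only [div1_eq_sum_grad hw.smooth]
  rw [integral_finsetSum _ fun a _ => hint a]
  simp only [integral_grad (hw.smooth _)]
  rw [← Finset.mul_sum, ← integral_finsetSum _ fun a _ =>
    SmoothFn.integrable (SmoothOn.mul (smoothFn_coordFn a) (hw.smooth a))]
  simp only [coordFn, hw.tangent 0 trivial, integral_zero, mul_zero]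

lemma pairing_grad (hw : SmoothForm w) (hf : SmoothFn f) :
    pairing w (grad f) = -∫ x, f x * div1 w x ∂area := by
  have hfw : SmoothForm fun x a => f x * w x a :=
    ⟨fun a => SmoothOn.mul hf (hw.smooth a), fun _ _ x => by
      simp only [mul_left_comm _ (f x), ← Finset.mul_sum, hw.tangent 0 trivial, mul_zero]⟩
  have h := integral_div1 hfw
  simp only [div1_mul hf hw] at h
  rw [integral_add (SmoothFn.integrable (SmoothOn.mul hf (hw.smoothOn_div1 uniqueDiffOn_univ)))
    (integrable_dot hw (hf.isSmoothOneForm_grad uniqueDiffOn_univ))] at h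
  rw [pairing]
  linarith

lemma pairing_div2 (hZ : SmoothForm Z) (hT : SmoothTensor T) :
    pairing Z (div2 T) = -∫ x, inner2 T (cov1 Z) x ∂area := by
  have h := integral_div1 (hT.contr hZ)
  simp only [div1_contr hT hZ] at h
  rw [integral_add (integrable_dot hZ (hT.div2 uniqueDiffOn_univ))
    (SmoothFn.integrable (hT.smoothOn_inner2 (hZ.cov1 uniqueDiffOn_univ)))] at h
  rw [pairing]
  linarith

lemma pairing_grad_coordFn_div2 (hT : SmoothTensor T) (k : Fin 3) :
    pairing (grad (coordFn k)) (div2 T) = ∫ x, coordFn k x * ∑ a, T x a a ∂area := by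
  have htrace (x : S2) : inner2 T (cov1 (grad (coordFn k))) x = -(coordFn k x * ∑ a, T x a a) := by
    have hσ (a) := sum_sigma_mul_of_tangent (hT.tangent_right 0 trivial x a) a
    rw [inner2_comm]
    simp only [inner2, cov1_grad_coordFn, neg_mul, Finset.sum_neg_distrib, mul_assoc,
      ← Finset.mul_sum, hσ]
  simp only [pairing_div2 (smoothForm_grad_coordFn k) hT, htrace, integral_neg, neg_neg]

lemma pairing_killing_div2 (hT : SmoothTensor T) (k : Fin 3) :
    pairing (killing k) (div2 T) = -∫ x, coordFn k x * inner2 eps T x ∂area := by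
  simp only [pairing_div2 (smoothForm_killing k) hT, inner2_comm T]
  simp only [inner2, cov1_killing, Finset.mul_sum, mul_assoc]

lemma pairing_grad_coordFn_grad (hf : SmoothFn f) (k : Fin 3) :
    pairing (grad (coordFn k)) (grad f) = 2 * ∫ x, coordFn k x * f x ∂area := by
  have hdiv (x : S2) : div1 (grad (coordFn k)) x = -(coordFn k x * 2) := by
    simp only [div1, cov1_grad_coordFn, Finset.sum_neg_distrib, ← Finset.mul_sum, sum_sigma_self]
  rw [pairing_grad (smoothForm_grad_coordFn k) hf, ← integral_neg, ← integral_const_mul]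
  refine integral_congr_ae (.of_forall fun x => ?_)
  simp only [hdiv]
  ring

lemma pairing_killing_grad (hf : SmoothFn f) (k : Fin 3) :
    pairing (killing k) (grad f) = 0 := by
  have hdiv (x : S2) : div1 (killing k) x = 0 := by
    have heps (a) : eps x a a = 0 := by linarith [eps_antisymm x a a]
    simp only [div1, cov1_killing, heps, mul_zero, Finset.sum_const_zero]
  simp only [pairing_grad (smoothForm_killing k) hf, hdiv, mul_zero, integral_zero, neg_zero]

lemma pairing_grad_coordFn_div2_curl (hw : SmoothForm w) (k : Fin 3) :
    pairing (grad (coordFn k)) (div2 (curl w)) = 0 := by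
  simp only [pairing_grad_coordFn_div2 (hw.curl uniqueDiffOn_univ), sum_curl_self, mul_zero,
    integral_zero]

lemma pairing_killing_div2_curl (hw : SmoothForm w) (k : Fin 3) :
    pairing (killing k) (div2 (curl w)) = -2 * pairing (killing k) w := by
  have hdiv (x : S2) : inner2 eps (curl w) x = 2 * div1 (contr eps w) x := by
    rw [inner2_comm, inner2_curl_eps, div1_contr smoothTensor_eps hw]
    simp only [dot, div2_eps, mul_zero, Finset.sum_const_zero, zero_add]
  have hneg : pairing (killing k) w = ∫ x, coordFn k x * div1 (contr eps w) x ∂area := by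
    rw [← neg_eq_iff_eq_neg.2 (pairing_grad (smoothTensor_eps.contr hw) (smoothFn_coordFn k)),
      pairing_comm]
    simp only [pairing, killing, dot_contr_eps w, integral_neg, neg_neg]
  rw [pairing_killing_div2 (hw.curl uniqueDiffOn_univ), hneg]
  simp only [hdiv, mul_left_comm _ (2 : ℝ), integral_const_mul]
  ring

lemma pairing_killing_div2_curl_div2 (hT : SmoothTensor T) (hsymm : ∀ x a b, T x a b = T x b a)
    (k : Fin 3) : pairing (killing k) (div2 (curl (div2 T))) = 0 := by
  simp only [pairing_killing_div2_curl (hT.div2 uniqueDiffOn_univ), pairing_killing_div2 hT,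
    inner2_comm eps T, inner2_eps_of_symm hsymm, mul_zero, integral_zero, neg_zero]

lemma integral_coordFn_mul_div1_div2 (hT : SmoothTensor T) (k : Fin 3) :
    ∫ x, coordFn k x * div1 (div2 T) x ∂area = -∫ x, coordFn k x * ∑ a, T x a a ∂area := by
  rw [← pairing_grad_coordFn_div2 hT, pairing_comm,
    pairing_grad (hT.div2 uniqueDiffOn_univ) (smoothFn_coordFn k), neg_neg]

end IntegralIdentities

section Evolution

variable {I : Set ℝ} {u : ℝ} {x : S2} {Z : OneForm} {w w' : ℝ → OneForm} {T T' : ℝ → TwoTensor}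

lemma IsSmoothTwoTensor.hasDerivWithinAt_div2 (hI : Convex ℝ I) (hI' : (interior I).Nonempty)
    (hT : IsSmoothTwoTensor I T)
    (hT' : ∀ u ∈ I, ∀ x a b, HasDerivWithinAt (fun s => T s x a b) (T' u x a b) I u)
    (hu : u ∈ I) (b : Fin 3) :
    HasDerivWithinAt (fun s => BondiSachs.div2 (T s) x b) (BondiSachs.div2 (T' u) x b) I u :=
  .fun_sum fun a _ => .fun_sum fun c _ => .fun_sum fun d _ =>
    ((hT.smooth c d).hasDerivWithinAt_grad hI hI' (fun u hu x => hT' u hu x c d) hu x a).const_mul _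

lemma hasDerivWithinAt_contr {S : TwoTensor} {v : OneForm}
    (hT : ∀ a b, HasDerivWithinAt (fun s => T s x a b) (S x a b) I u)
    (hw : ∀ a, HasDerivWithinAt (fun s => w s x a) (v x a) I u) (a : Fin 3) :
    HasDerivWithinAt (fun s => contr (T s) (w s) x a) (contr S (w u) x a + contr (T u) v x a)
      I u :=
  (HasDerivWithinAt.fun_sum fun d _ => (hT a d).fun_mul (hw d)).congr_deriv Finset.sum_add_distrib

lemma hasDerivWithinAt_normSq2 {S : TwoTensor}
    (hT : ∀ a b, HasDerivWithinAt (fun s => T s x a b) (S x a b) I u) :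
    HasDerivWithinAt (fun s => normSq2 (T s) x) (2 * inner2 (T u) S x) I u := by
  simp only [normSq2, inner2]
  refine (HasDerivWithinAt.fun_sum fun a _ => HasDerivWithinAt.fun_sum fun b _ =>
    (hT a b).fun_mul (hT a b)).congr_deriv ?_
  simp only [Finset.mul_sum]
  exact Finset.sum_congr rfl fun a _ => Finset.sum_congr rfl fun b _ => by ring

lemma hasDerivWithinAt_pairing (hI : Convex ℝ I) (hI' : (interior I).Nonempty)
    (hZ : SmoothForm Z) (hw : IsSmoothOneForm I w)
    (hw' : ∀ u ∈ I, ∀ x a, HasDerivWithinAt (fun s => w s x a) (w' u x a) I u) (hu : u ∈ I) :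
    HasDerivWithinAt (fun s => pairing Z (w s)) (pairing Z (w' u)) I u :=
  SmoothOn.hasDerivWithinAt_integral hI hI'
    (SmoothOn.sum fun a _ => (SmoothFn.family (hZ.smooth a) I).mul (hw.smooth a))
    (fun u hu x => .fun_sum fun a _ => (hw' u hu x a).const_mul (Z x a)) hu

end Evolution

namespace NullInfinityData

variable {I : Set ℝ} {u : ℝ} {Z : OneForm} (D : NullInfinityData I)

/-- The one-form `C_A^B ∇^D N_{BD} - N_A^B ∇^D C_{BD}`, the flux density of angular momentum. -/
def flux (u : ℝ) : OneForm :=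
  contr (D.shear u) (div2 (D.news u)) - contr (D.news u) (div2 (D.shear u))

/-- The one-form `N_A - 1/4 C_A^D ∇^E C_{DE}`, which is paired with the rotation fields and the
gradients `∇X̃^k` in the charges. -/
def chargeAspect (u : ℝ) : OneForm :=
  D.ang u - (1 / 4 : ℝ) • contr (D.shear u) (div2 (D.shear u))

lemma isSmoothTwoTensor_shear : IsSmoothTwoTensor I D.shear := D.smooth_shear.isSmoothTwoTensor

lemma isSmoothTwoTensor_news : IsSmoothTwoTensor I D.news := D.smooth_news.isSmoothTwoTensor

lemma isSmoothOneForm_flux (hI : UniqueDiffOn ℝ I) : IsSmoothOneForm I D.flux :=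
  (D.isSmoothTwoTensor_shear.contr (D.isSmoothTwoTensor_news.div2 hI)).sub
    (D.isSmoothTwoTensor_news.contr (D.isSmoothTwoTensor_shear.div2 hI))

lemma isSmoothOneForm_chargeAspect (hI : UniqueDiffOn ℝ I) : IsSmoothOneForm I D.chargeAspect :=
  D.smooth_ang.sub
    ((D.isSmoothTwoTensor_shear.contr (D.isSmoothTwoTensor_shear.div2 hI)).const_smul _)

lemma hasDerivWithinAt_chargeAspect (hI : Convex ℝ I) (hI' : (interior I).Nonempty) (hu : u ∈ I)
    (x : S2) (a : Fin 3) :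
    HasDerivWithinAt (fun s => D.chargeAspect s x a)
      ((grad (D.m u) + (1 / 4 : ℝ) • (grad (inner2 (D.shear u) (D.news u))
        - div2 (curl (div2 (D.shear u))) - div2 (mul2 (D.shear u) (D.news u)) + D.flux u)) x a)
      I u := by
  have hdivC :=
    D.isSmoothTwoTensor_shear.hasDerivWithinAt_div2 (x := x) hI hI' D.shear_evol hu
  refine ((D.ang_evol u hu x a).sub ((hasDerivWithinAt_contr (D.shear_evol u hu x) hdivC
    a).const_mul (1 / 4))).congr_deriv ?_
  simp only [flux, Pi.add_apply, Pi.sub_apply, Pi.smul_apply, smul_eq_mul]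
  change grad (D.m u) x a - 1 / 4 * div2 (curl (div2 (D.shear u))) x a + _ - _ + _ - _ = _
  ring

lemma hasDerivWithinAt_pairing_chargeAspect (hI : Convex ℝ I) (hI' : (interior I).Nonempty)
    (hu : u ∈ I) (hZ : SmoothForm Z) :
    HasDerivWithinAt (fun s => pairing Z (D.chargeAspect s))
      (pairing Z (grad (D.m u)) + 1 / 4 * (pairing Z (grad (inner2 (D.shear u) (D.news u)))
        - pairing Z (div2 (curl (div2 (D.shear u))))
        - pairing Z (div2 (mul2 (D.shear u) (D.news u))) + pairing Z (D.flux u))) I u := by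
  have hU := uniqueDiffOn_convex hI hI'
  have hC := D.isSmoothTwoTensor_shear
  have hN := D.isSmoothTwoTensor_news
  have hm := (D.smooth_m.isSmoothOneForm_grad hU).slice hu
  have hCN := ((hC.smoothOn_inner2 hN).isSmoothOneForm_grad hU).slice hu
  have hcurl := (((hC.div2 hU).curl hU).div2 hU).slice hu
  have hdiv := ((hC.mul2 hN).div2 hU).slice hu
  have hflux := (D.isSmoothOneForm_flux hU).slice hu
  refine (hasDerivWithinAt_pairing hI hI' hZ (D.isSmoothOneForm_chargeAspect hU)
    (fun u hu => D.hasDerivWithinAt_chargeAspect hI hI' hu) hu).congr_deriv ?_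
  have hsub := hCN.sub hcurl
  have hsub' := hsub.sub hdiv
  rw [pairing_add hZ hm ((hsub'.add hflux).const_smul _), pairing_smul,
    pairing_add hZ hsub' hflux, pairing_sub hZ hsub hdiv, pairing_sub hZ hCN hcurl]

lemma angularMomentum_eq_pairing (k : Fin 3) (s : ℝ) :
    D.angularMomentum k s = pairing (killing k) (D.chargeAspect s) := by
  simp only [angularMomentum, pairing, dot, killing, contr, Finset.sum_mul, chargeAspect,
    Pi.sub_apply, Pi.smul_apply, smul_eq_mul]

lemma centerOfMass_eq_pairing (hI : UniqueDiffOn ℝ I) (hu : u ∈ I) (k : Fin 3) :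
    D.centerOfMass k u = pairing (grad (coordFn k)) (D.chargeAspect u)
      - 2 * u * ∫ x, coordFn k x * D.m u x ∂area
      - 1 / 8 * ∫ x, coordFn k x * normSq2 (D.shear u) x ∂area := by
  have hZ := smoothForm_grad_coordFn k
  have hC := D.isSmoothTwoTensor_shear
  have hP := (D.isSmoothOneForm_chargeAspect hI).slice hu
  have hm := ((D.smooth_m.isSmoothOneForm_grad hI).const_smul u).slice hu
  have hCC : SmoothOn I fun s => normSq2 (D.shear s) := hC.smoothOn_inner2 hC
  have hCC' := ((hCC.isSmoothOneForm_grad hI).const_smul (1 / 16)).slice hu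
  calc D.centerOfMass k u
      = pairing (grad (coordFn k)) (D.chargeAspect u - u • grad (D.m u)
          - (1 / 16 : ℝ) • grad (normSq2 (D.shear u))) := by
        simp only [centerOfMass, pairing, dot, chargeAspect, Pi.sub_apply, Pi.smul_apply,
          smul_eq_mul, sub_right_comm _ (u * _)]
    _ = _ := by
        rw [pairing_sub hZ (hP.sub hm) hCC', pairing_sub hZ hP hm, pairing_smul, pairing_smul,
          pairing_grad_coordFn_grad (D.smooth_m.slice hu), pairing_grad_coordFn_grad (hCC.slice hu)]
        ring

lemma hasDerivWithinAt_integral_coordFn_mul_m (hI : Convex ℝ I) (hI' : (interior I).Nonempty)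
    (hu : u ∈ I) (k : Fin 3) :
    HasDerivWithinAt (fun s => ∫ x, coordFn k x * D.m s x ∂area)
      (-(1 / 8) * ∫ x, coordFn k x * normSq2 (D.news u) x ∂area) I u := by
  have hX := smoothFn_coordFn k
  have hN := D.isSmoothTwoTensor_news.slice hu
  have hNN : SmoothFn fun x => coordFn k x * normSq2 (D.news u) x :=
    SmoothOn.mul hX (hN.smoothOn_inner2 hN)
  have hdiv : SmoothFn fun x => coordFn k x * div1 (div2 (D.news u)) x :=
    SmoothOn.mul hX ((hN.div2 uniqueDiffOn_univ).smoothOn_div1 uniqueDiffOn_univ)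
  have hdiv0 : ∫ x, coordFn k x * div1 (div2 (D.news u)) x ∂area = 0 := by
    simp only [integral_coordFn_mul_div1_div2 hN, D.smooth_news.traceless u hu, mul_zero,
      integral_zero, neg_zero]
  refine (((hX.family I).mul D.smooth_m).hasDerivWithinAt_integral hI hI'
    (fun s hs x => (D.m_evol s hs x).const_mul (coordFn k x)) hu).congr_deriv ?_
  simp only [mul_add, mul_left_comm (coordFn k _)]
  rw [integral_add (hNN.integrable.const_mul _) (hdiv.integrable.const_mul _),
    integral_const_mul, integral_const_mul, hdiv0, mul_zero, add_zero]

lemma hasDerivWithinAt_integral_coordFn_mul_normSq2_shear (hI : Convex ℝ I)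
    (hI' : (interior I).Nonempty) (hu : u ∈ I) (k : Fin 3) :
    HasDerivWithinAt (fun s => ∫ x, coordFn k x * normSq2 (D.shear s) x ∂area)
      (2 * ∫ x, coordFn k x * inner2 (D.shear u) (D.news u) x ∂area) I u := by
  have hC := D.isSmoothTwoTensor_shear
  refine ((((smoothFn_coordFn k).family I).mul (hC.smoothOn_inner2 hC)).hasDerivWithinAt_integral
    hI hI' (fun s hs x => (hasDerivWithinAt_normSq2 (D.shear_evol s hs x)).const_mul
      (coordFn k x)) hu).congr_deriv ?_
  simp only [mul_left_comm _ (2 : ℝ), integral_const_mul]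

lemma hasDerivWithinAt_angularMomentum (hI : Convex ℝ I) (hI' : (interior I).Nonempty)
    (hu : u ∈ I) (k : Fin 3) :
    HasDerivWithinAt (D.angularMomentum k)
      (1 / 4 * ∫ x, (dot (killing k) (D.flux u) x
        + coordFn k x * inner2 eps (mul2 (D.shear u) (D.news u)) x) ∂area) I u := by
  have hU := uniqueDiffOn_convex hI hI'
  have hC := D.isSmoothTwoTensor_shear.slice hu
  have hN := D.isSmoothTwoTensor_news.slice hu
  have hCN := hC.mul2 hN
  have hflux := integrable_dot (smoothForm_killing k) ((D.isSmoothOneForm_flux hU).slice hu)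
  have hspin : SmoothFn fun x => coordFn k x * inner2 eps (mul2 (D.shear u) (D.news u)) x :=
    SmoothOn.mul (smoothFn_coordFn k) (smoothTensor_eps.smoothOn_inner2 hCN)
  rw [funext (D.angularMomentum_eq_pairing k), integral_add hflux hspin.integrable]
  refine (D.hasDerivWithinAt_pairing_chargeAspect hI hI' hu (smoothForm_killing k)).congr_deriv ?_
  rw [pairing_killing_grad (D.smooth_m.slice hu), pairing_killing_grad (hC.smoothOn_inner2 hN),
    pairing_killing_div2_curl_div2 hC (D.smooth_shear.symm u hu), pairing_killing_div2 hCN]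
  simp only [pairing]
  ring

lemma hasDerivWithinAt_centerOfMass (hI : Convex ℝ I) (hI' : (interior I).Nonempty)
    (hu : u ∈ I) (k : Fin 3) :
    HasDerivWithinAt (D.centerOfMass k)
      (1 / 4 * pairing (grad (coordFn k)) ((u / 2) • grad (normSq2 (D.news u)) + D.flux u))
      I u := by
  have hU := uniqueDiffOn_convex hI hI'
  have hZ := smoothForm_grad_coordFn k
  have hC := D.isSmoothTwoTensor_shear.slice hu
  have hN := D.isSmoothTwoTensor_news.slice hu
  have hNN : SmoothFn (normSq2 (D.news u)) := hN.smoothOn_inner2 hN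
  have hrate := ((D.hasDerivWithinAt_pairing_chargeAspect hI hI' hu hZ).sub
    (((hasDerivWithinAt_id u I).const_mul 2).mul
      (D.hasDerivWithinAt_integral_coordFn_mul_m hI hI' hu k))).sub
    ((D.hasDerivWithinAt_integral_coordFn_mul_normSq2_shear hI hI' hu k).const_mul (1 / 8))
  refine (hrate.congr (fun s hs => D.centerOfMass_eq_pairing hU hs k)
    (D.centerOfMass_eq_pairing hU hu k)).congr_deriv ?_
  rw [pairing_grad_coordFn_grad (D.smooth_m.slice hu),
    pairing_grad_coordFn_grad (hC.smoothOn_inner2 hN),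
    pairing_grad_coordFn_div2_curl (hC.div2 uniqueDiffOn_univ),
    pairing_grad_coordFn_div2 (hC.mul2 hN),
    pairing_add hZ ((hNN.isSmoothOneForm_grad uniqueDiffOn_univ).const_smul _)
      ((D.isSmoothOneForm_flux hU).slice hu), pairing_smul, pairing_grad_coordFn_grad hNN]
  simp only [sum_mul2_self _ (D.smooth_news.symm u hu), id]
  ring

end NullInfinityData

end BondiSachs

end

theorem theorem1 (I : Set ℝ) (hI : I.OrdConnected) (hI' : I.Nontrivial)
    (D : NullInfinityData I) (k : Fin 3) (u : ℝ) (hu : u ∈ I) :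
    HasDerivWithinAt (D.angularMomentum k)
      (1 / 4 * ∫ x, ((∑ a, ∑ e, eps x a e * grad (coordFn k) x e *
            (contr (D.shear u) (div2 (D.news u)) x a
              - contr (D.news u) (div2 (D.shear u)) x a))
          + coordFn k x * ∑ a, ∑ b, eps x a b * mul2 (D.shear u) (D.news u) x a b) ∂area) I u ∧
    HasDerivWithinAt (D.centerOfMass k)
      (1 / 4 * ∫ x, (∑ a, grad (coordFn k) x a *
          (u / 2 * grad (normSq2 (D.news u)) x a
            + contr (D.shear u) (div2 (D.news u)) x a
            - contr (D.news u) (div2 (D.shear u)) x a)) ∂area) I u := by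
  have hconv : Convex ℝ I := hI.convex
  have hint := hconv.nontrivial_iff_nonempty_interior.1 hI'
  refine ⟨(D.hasDerivWithinAt_angularMomentum hconv hint hu k).congr_deriv ?_,
    (D.hasDerivWithinAt_centerOfMass hconv hint hu k).congr_deriv ?_⟩
  · simp only [dot, killing, contr, NullInfinityData.flux, inner2, Finset.sum_mul, Pi.sub_apply]
  · simp only [pairing, dot, NullInfinityData.flux, Pi.add_apply, Pi.sub_apply, Pi.smul_apply,
      smul_eq_mul, add_sub_assoc]
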